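/- **Model.** Consider a network with a finite node set $\mathcal N$, a finite set of directed links $\mathcal E\subseteq\mathcal N\times\mathcal N$ and a finite set $\mathcal K$ of traffic types, type $k$ being destined for the nodes of a set $\mathcal N_k\subseteq\mathcal N$. For each pair $(i,k)$ with $i\notin\mathcal N_k$ node $i$ keeps a queue $i^k$; let $M$ be the number of queues. Let $\hat P_i$ be the peak power of node $i$, let $\Pi$ be the set of power vectors $P\in\mathbb R_+^{\mathcal E}$ with $\sum_{j:(i,j)\in\mathcal E}P_{ij}\le\hat P_i$ for all $i$, let $\mathcal C(P)\subseteq\mathbb R_+^{\mathcal E}$ be the set of link-rate vectors feasible under $P$, and suppose that $\mathcal C(\Pi)=\mathrm{conv}\bigl(\bigcup_{P\in\Pi}\mathcal C(P)\bigr)$ is compact. Per-type service rates $R=(R_{ij}^k)$ are feasible if $R_{ij}^k\ge0$, $R_{ij}^k=0$ whenever $i\in\mathcal N_k$, and $(\sum_kR_{ij}^k)_{(i,j)\in\mathcal E}\in\mathcal C(\Pi)$. They induce the virtual service rates $\tilde R_i^k=\sum_{j:(i,j)\in\mathcal E}R_{ij}^k-\sum_{m:(m,i)\in\mathcal E}R_{mi}^k$,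 one for each queue $i^k$; the (compact, convex) set of all virtual rate vectors induced by feasible rates is the virtual rate region $\mathcal C\subset\mathbb R^M$. **Arrivals.** The vectors $B[t]\in\mathbb R_+^M$ of the work arriving at the queues during the slots $[t,t+1)$, $t=0,1,2,\dots$, are i.i.d. with finite second moments and mean vector $a$. **Iterative MDB policy with convergence time (one slot).** Let $U[t]\in\mathbb R_+^M$ be the queue state at the start of slot $t$; $U[0]$ and $U[1]$ are arbitrary initial states, and the system is non-anticipating: $B[t]$ is independent of the history up to time $t$ (in particular of $U[0],\dots,U[t]$). From time $\tau=1$ on, the instantaneous rates $R(\tau)$ are feasible and integrable over each slot, and the induced virtual rates $\tilde R(\tau)$ satisfy, almost surely: 1. for every $t\ge0$, $\tilde R(t+1)$ maximizes $U[t]\cdot r$ over $r\in\mathcal C$ (any maximizer is allowed); 2. for every $t\ge1$, $\tau\mapsto U[t]\cdot\tilde R(\tau)$ is nondecreasing on $[t,t+1)$; 3. for every $t\ge1$, $U[t+1]\le\bigl(U[t]-\tilde R[t]+B[t]\bigr)^+$ componentwise, where $\tilde R[t]=\int_t^{t+1}\tilde R(\tau)\,d\tau$. **Theorem 4.** The iterative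 MDB policy with convergence time is throughput optimal: if $a\in\mathrm{int}\,\mathcal C$, then every queue $i^k$ is stable, that is, $$\limsup_{n\to\infty}\frac1n\sum_{t=1}^n\mathbb P\bigl[U_i^k[t]>\xi\bigr]\longrightarrow0\qquad\text{as }\xi\to\infty.$$ -/

import Mathlib

open MeasureTheory ProbabilityTheory Filter Topology

/-- A wireless multi-hop network with nodes `N` and traffic types `K`: directed links, the
destination set of each traffic type, the peak power of each node, and the instantaneous feasible
rate region of each power allocation (a general set of nonnegative link-rate vectors). -/
structure WirelessNetwork (N K : Type*) where
  links : Finset (N × N)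
  dest : K → Finset N
  peakPower : N → ℝ
  instRegion : (links → ℝ) → Set (links → ℝ)
  instRegion_nonneg : ∀ P, ∀ R ∈ instRegion P, ∀ e, 0 ≤ R e

namespace WirelessNetwork

variable {N K : Type*} [Fintype N] [DecidableEq N] [Fintype K]

/-- The directed links `(i, j)` of the network. -/
abbrev Link (net : WirelessNetwork N K) : Type _ := net.links

/-- The queues `i^k`: node `i` keeps a buffer for type `k` exactly when `i` is not a destination
of type `k`. -/
abbrev Queue (net : WirelessNetwork N K) : Type _ := {q : N × K // q.1 ∉ net.dest q.2}

/-- The feasible power allocations: nonnegative, with the power spent on the links out of each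
node at most the peak power of that node. -/
def feasiblePower (net : WirelessNetwork N K) : Set (net.Link → ℝ) :=
  {P | (∀ e, 0 ≤ P e) ∧ ∀ i, ∑ e : net.Link with e.1.1 = i, P e ≤ net.peakPower i}

/-- The long-term feasible service rate region: the convex hull of the union of the instantaneous
regions over all feasible power allocations. -/
def longTermRegion (net : WirelessNetwork N K) : Set (net.Link → ℝ) :=
  convexHull ℝ (⋃ P ∈ net.feasiblePower, net.instRegion P)

/-- Feasible per-type service rates `R e k` (the rate at which link `e = (i, j)` serves queue
`i^k`): nonnegative, zero where there is no queue `i^k` to serve, and with aggregate link rates in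
the long-term feasible region. -/
def serviceRegion (net : WirelessNetwork N K) : Set (net.Link → K → ℝ) :=
  {R | (∀ e k, 0 ≤ R e k) ∧ (∀ e k, e.1.1 ∈ net.dest k → R e k = 0) ∧
    (fun e => ∑ k, R e k) ∈ net.longTermRegion}

/-- The virtual service rate of each queue: outgoing minus (nominal) incoming service rate. -/
def virtualRate (net : WirelessNetwork N K) (R : net.Link → K → ℝ) : net.Queue → ℝ :=
  fun q => ∑ e : net.Link with e.1.1 = q.1.1, R e q.1.2
    - ∑ e : net.Link with e.1.2 = q.1.1, R e q.1.2

/-- The virtual service rate region. -/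
def virtualRegion (net : WirelessNetwork N K) : Set (net.Queue → ℝ) :=
  net.virtualRate '' net.serviceRegion

/-- `r` is an optimal rate allocation for the queue state `u`: it maximizes `u ⬝ᵥ r` over the
virtual service rate region. -/
def IsOptimalRate (net : WirelessNetwork N K) (u r : net.Queue → ℝ) : Prop :=
  r ∈ net.virtualRegion ∧ ∀ r' ∈ net.virtualRegion, u ⬝ᵥ r' ≤ u ⬝ᵥ r

/-- The virtual service rates over the slot `[t, t + 1]`. -/
noncomputable def slotRate (net : WirelessNetwork N K) (R : ℝ → net.Link → K → ℝ) (t : ℕ) :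
    net.Queue → ℝ :=
  fun q => ∫ τ in (t : ℝ)..((t : ℝ) + 1), net.virtualRate (R τ) q

/-- One sample path of the network under the iterative MDB policy with convergence time (one slot,
of length one): `u t` is the backlog at the start of slot `t`, `b t` the arrivals during slot `t`
and `R τ` the per-type service rates at the continuous time `τ`. The policy runs from slot `1`
on; `u 0` and `u 1` are the initial data. -/
structure IterativeMDBPath (net : WirelessNetwork N K) (b u : ℕ → net.Queue → ℝ)
    (R : ℝ → net.Link → K → ℝ) : Prop where
  backlog_nonneg : ∀ t q, 0 ≤ u t q
  feasible : ∀ τ : ℝ, 1 ≤ τ → R τ ∈ net.serviceRegion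
  integrable : ∀ t : ℕ, 1 ≤ t → ∀ e k,
    IntervalIntegrable (fun τ => R τ e k) volume (t : ℝ) ((t : ℝ) + 1)
  /-- At the end of slot `t`, which is the start of slot `t + 1`, the rates are optimal for the
  queue state at the start of slot `t`. -/
  optimal : ∀ t : ℕ, net.IsOptimalRate (u t) (net.virtualRate (R ((t : ℝ) + 1)))
  /-- During slot `t` the objective value for the current queue state does not decrease. -/
  monotone : ∀ t : ℕ, 1 ≤ t →
    MonotoneOn (fun τ : ℝ => u t ⬝ᵥ net.virtualRate (R τ)) (Set.Ico (t : ℝ) ((t : ℝ) + 1))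
  dynamics : ∀ t : ℕ, 1 ≤ t → ∀ q, u (t + 1) q ≤ max (u t q - net.slotRate R t q + b t q) 0

/-- The network with random arrivals `B`, operated by the iterative MDB policy with convergence
time: almost every sample path is a path of the policy, and the system is non-anticipating, that
is, the arrivals during slot `t` are independent of the history up to the start of slot `t`. -/
structure IsIterativeMDB (net : WirelessNetwork N K) {Ω : Type*} [mΩ : MeasurableSpace Ω]
    (μ : Measure Ω) (B U : ℕ → Ω → net.Queue → ℝ) (R : ℝ → Ω → net.Link → K → ℝ) : Prop where
  path : ∀ᵐ ω ∂μ, net.IterativeMDBPath (fun t => B t ω) (fun t => U t ω) (fun τ => R τ ω)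
  causal : ∃ ℱ : Filtration ℕ mΩ,
    (∀ t, Measurable[ℱ t] (U t)) ∧ (∀ t, Measurable[ℱ (t + 1)] (B t)) ∧
      ∀ t, Indep (MeasurableSpace.comap (B t) inferInstance) (ℱ t) μ

end WirelessNetwork

/-- `B 0, B 1, …` are i.i.d. nonnegative random vectors with finite second moments and mean
vector `a`. -/
structure IsIIDArrival {Ω ι : Type*} [MeasurableSpace Ω] (μ : Measure Ω)
    (B : ℕ → Ω → ι → ℝ) (a : ι → ℝ) : Prop where
  measurable : ∀ t, Measurable (B t)
  indep : iIndepFun B μ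
  identDistrib : ∀ t, IdentDistrib (B t) (B 0) μ μ
  nonneg : ∀ t, ∀ᵐ ω ∂μ, ∀ q, 0 ≤ B t ω q
  memLp_two : ∀ t q, MemLp (fun ω => B t ω q) 2 μ
  mean : ∀ t q, ∫ ω, B t ω q ∂μ = a q

/-- A queue with backlog process `X` is stable if
`limsup_{n → ∞} (1/n) ∑_{t=1}^n P(X t > ξ) → 0` as `ξ → ∞`. -/
def IsStableQueue {Ω : Type*} [MeasurableSpace Ω] (μ : Measure Ω) (X : ℕ → Ω → ℝ) : Prop :=
  Tendsto (fun ξ : ℝ =>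
    limsup (fun n : ℕ => (1 / (n : ℝ)) * ∑ t ∈ Finset.Icc 1 n, μ.real {ω | ξ < X t ω}) atTop)
    atTop (𝓝 0)

namespace WirelessNetwork

/-! This is a Lyapunov drift argument for rates that lag one slot behind the queue state. Rates
optimal for `u s` lose at most a constant times the change `∑ |u (s+1) - u s|` when judged against
`u (s+1)`, and monotonicity of the objective carries this bound over the whole slot
(`dotProduct_le_slotRate`). Backlogs can fall arbitrarily far in one slot, so this change has no
uniform bound. The Lyapunov function therefore adds `4 * D * (|x - y| + x)` to the usual square: the
`|x - y|` part stored one slot earlier pays for the loss, and the `x` part makes falls free, so that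
only rises, bounded by arrivals plus `D`, cost anything (`lyapunov_drift`). Since `a + ε` is still
feasible, the drift contains `-2 * ε * ∑ u`, and telescoping bounds the accumulated backlog on each
path (`sum_backlog_le`).

In expectation the cross terms `u * (b - a)` vanish by non-anticipation. The initial states need not
be integrable, so expectations are taken on an event of probability close to one, decided at time 1,
on which the initial data are bounded. Markov's inequality then gives stability
(`IsStableQueue.of_forall_exists_truncation`). -/

/-- The virtual service rate region is bounded if the long-term region is compact. -/
lemma exists_abs_le_of_mem_virtualRegion {N K : Type*} [DecidableEq N] [Fintype K]
    (net : WirelessNetwork N K)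
    (hcompact : IsCompact net.longTermRegion) :
    ∃ D : ℝ, 0 ≤ D ∧ ∀ r ∈ net.virtualRegion, ∀ q, |r q| ≤ D := by
  obtain ⟨C, hC⟩ := hcompact.isBounded.exists_norm_le
  have hsum : ∀ (R : net.Link → K → ℝ), R ∈ net.serviceRegion → ∀ (s : Finset net.Link) k,
      0 ≤ ∑ e ∈ s, R e k ∧ ∑ e ∈ s, R e k ≤ Fintype.card net.Link * |C| := by
    rintro R ⟨hR0, -, hR⟩ s k
    refine ⟨Finset.sum_nonneg fun e _ => hR0 e k, ?_⟩
    calc ∑ e ∈ s, R e k ≤ ∑ e, R e k :=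
          Finset.sum_le_sum_of_subset_of_nonneg (Finset.subset_univ s) fun e _ _ => hR0 e k
      _ ≤ ∑ _e : net.Link, |C| := by
          refine Finset.sum_le_sum fun e _ => ?_
          calc R e k ≤ ∑ k, R e k :=
                Finset.single_le_sum (f := fun k => R e k) (fun k _ => hR0 e k)
                  (Finset.mem_univ k)
            _ ≤ ‖∑ k, R e k‖ := Real.le_norm_self _
            _ ≤ ‖fun e => ∑ k, R e k‖ := norm_le_pi_norm (fun e => ∑ k, R e k) e
            _ ≤ |C| := (hC _ hR).trans (le_abs_self C)
      _ = Fintype.card net.Link * |C| := by simp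
  refine ⟨Fintype.card net.Link * |C|, by positivity, ?_⟩
  rintro _ ⟨R, hR, rfl⟩ q
  have h₁ := hsum R hR {e | e.1.1 = q.1.1} q.1.2
  have h₂ := hsum R hR {e | e.1.2 = q.1.1} q.1.2
  rw [virtualRate, abs_le]
  constructor <;> linarith [h₁.1, h₁.2, h₂.1, h₂.2]

variable {N K : Type*} [Fintype N] [DecidableEq N] [Fintype K]

/-! ### Near-optimality of the delayed rates on a sample path -/

namespace IterativeMDBPath

variable {net : WirelessNetwork N K} {b u : ℕ → net.Queue → ℝ} {R : ℝ → net.Link → K → ℝ}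

lemma intervalIntegrable_virtualRate (h : net.IterativeMDBPath b u R) {t : ℕ} (ht : 1 ≤ t)
    (q : net.Queue) :
    IntervalIntegrable (fun τ => net.virtualRate (R τ) q) volume (t : ℝ) ((t : ℝ) + 1) := by
  have hsum : ∀ s : Finset net.Link, IntervalIntegrable (fun τ => ∑ e ∈ s, R τ e q.1.2) volume
      (t : ℝ) ((t : ℝ) + 1) := fun s => by
    have := IntervalIntegrable.sum s (f := fun e τ => R τ e q.1.2)
      fun e _ => h.integrable t ht e q.1.2
    simpa only [Finset.sum_fn] using this
  exact (hsum _).sub (hsum _)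

lemma abs_slotRate_le (h : net.IterativeMDBPath b u R) {D : ℝ}
    (hD : ∀ r ∈ net.virtualRegion, ∀ q, |r q| ≤ D) {t : ℕ} (ht : 1 ≤ t) (q : net.Queue) :
    |net.slotRate R t q| ≤ D := by
  have ht' : (1 : ℝ) ≤ t := by exact_mod_cast ht
  have := intervalIntegral.norm_integral_le_of_norm_le_const (a := (t : ℝ)) (b := t + 1) (C := D)
    (f := fun τ => net.virtualRate (R τ) q) fun τ hτ => by
      rw [Set.uIoc_of_le (by linarith)] at hτ
      exact hD _ ⟨R τ, h.feasible τ (by linarith [hτ.1]), rfl⟩ q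
  simpa [slotRate] using this

/-- The slot service rate is at least as good for the current backlog as the rate at the start of
the slot. -/
lemma dotProduct_virtualRate_le_slotRate (h : net.IterativeMDBPath b u R) {t : ℕ} (ht : 1 ≤ t) :
    u t ⬝ᵥ net.virtualRate (R t) ≤ u t ⬝ᵥ net.slotRate R t := by
  have hint : ∀ q ∈ (Finset.univ : Finset net.Queue), IntervalIntegrable
      (fun τ => u t q * net.virtualRate (R τ) q) volume (t : ℝ) ((t : ℝ) + 1) :=
    fun q _ => (h.intervalIntegrable_virtualRate ht q).const_mul _
  have hslot : u t ⬝ᵥ net.slotRate R t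
      = ∫ τ in (t : ℝ)..((t : ℝ) + 1), u t ⬝ᵥ net.virtualRate (R τ) := by
    simp only [dotProduct, slotRate]
    rw [intervalIntegral.integral_finsetSum hint]
    simp
  have hdot : IntervalIntegrable (fun τ => u t ⬝ᵥ net.virtualRate (R τ)) volume
      (t : ℝ) ((t : ℝ) + 1) := by
    have := IntervalIntegrable.sum _ hint
    rw [Finset.sum_fn] at this
    exact this
  -- Comparison on the open slot suffices; at `t + 1` the rates may already have switched to a new
  -- maximizer.
  have hmono := intervalIntegral.integral_mono_on_of_le_Ioo (a := (t : ℝ)) (b := t + 1)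
    (f := fun _ => u t ⬝ᵥ net.virtualRate (R t)) (by linarith) intervalIntegrable_const hdot
    fun τ hτ => h.monotone t ht ⟨le_rfl, by linarith⟩ ⟨hτ.1.le, hτ.2⟩ hτ.1.le
  rw [hslot]
  simpa using hmono

/-- The slot service rate is nearly optimal for the current backlog: the loss against any feasible
rate is controlled by the change of the backlog during the preceding slot. -/
lemma dotProduct_le_slotRate (h : net.IterativeMDBPath b u R) {D : ℝ}
    (hD : ∀ r ∈ net.virtualRegion, ∀ q, |r q| ≤ D) {r : net.Queue → ℝ}
    (hr : r ∈ net.virtualRegion) (s : ℕ) :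
    u (s + 1) ⬝ᵥ r ≤ u (s + 1) ⬝ᵥ net.slotRate R (s + 1)
      + 2 * D * ∑ q, |u (s + 1) q - u s q| := by
  have hslot := h.dotProduct_virtualRate_le_slotRate (t := s + 1) (by omega)
  obtain ⟨hmem, hopt⟩ := h.optimal s
  push_cast at hslot
  set v := net.virtualRate (R (s + 1)) with hv
  -- Since `v` is optimal for `u s`, passing from `v` to `r` can gain only through the change of
  -- weights.
  have hpert : (u (s + 1) - u s) ⬝ᵥ (r - v) ≤ 2 * D * ∑ q, |u (s + 1) q - u s q| := by
    rw [dotProduct, Finset.mul_sum]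
    refine Finset.sum_le_sum fun q _ => ?_
    calc (u (s + 1) - u s) q * (r - v) q ≤ |u (s + 1) q - u s q| * |r q - v q| := by
          rw [← abs_mul]; exact le_abs_self _
      _ ≤ |u (s + 1) q - u s q| * (2 * D) := by
          gcongr
          linarith [abs_sub (r q) (v q), hD r hr q, hD v hmem q]
      _ = 2 * D * |u (s + 1) q - u s q| := mul_comm _ _
  have := hopt r hr
  rw [sub_dotProduct, dotProduct_sub, dotProduct_sub] at hpert
  linarith

end IterativeMDBPath

/-! ### Lyapunov drift on a sample path -/

/-- The Lyapunov function of the backlog `x`, given the backlog `y` one slot before. -/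
def lyapunov {ι : Type*} [Fintype ι] (D : ℝ) (x y : ι → ℝ) : ℝ :=
  ∑ q, (x q ^ 2 + 4 * D * (|x q - y q| + x q))

lemma lyapunov_nonneg {ι : Type*} [Fintype ι] {D : ℝ} (hD : 0 ≤ D) {x : ι → ℝ} (y : ι → ℝ)
    (hx : ∀ q, 0 ≤ x q) : 0 ≤ lyapunov D x y :=
  Finset.sum_nonneg fun q _ => by have := hx q; positivity

/-- The contribution of the arrivals of one slot to the drift of the Lyapunov function. -/
def arrivalCost {ι : Type*} [Fintype ι] (D : ℝ) (b : ι → ℝ) : ℝ :=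
  ∑ q, ((b q + D) ^ 2 + 8 * D * (b q + D))

namespace IterativeMDBPath

variable {net : WirelessNetwork N K} {b u : ℕ → net.Queue → ℝ} {R : ℝ → net.Link → K → ℝ}

/-- Only rises are controlled: the dynamics bound the next backlog from above, so there is no
matching lower bound. -/
lemma backlog_succ_le (h : net.IterativeMDBPath b u R) {D : ℝ}
    (hD : ∀ r ∈ net.virtualRegion, ∀ q, |r q| ≤ D) (hb : ∀ t q, 0 ≤ b t q) {t : ℕ} (ht : 1 ≤ t)
    (q : net.Queue) : u (t + 1) q ≤ u t q + (b t q + D) := by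
  have hr := abs_le.1 (h.abs_slotRate_le hD ht q)
  refine (h.dynamics t ht q).trans (max_le ?_ ?_) <;>
    linarith [hr.1, hr.2, hb t q, h.backlog_nonneg t q]

/-- One-slot drift of the Lyapunov function. -/
lemma lyapunov_drift (h : net.IterativeMDBPath b u R) {D ε : ℝ} {a : net.Queue → ℝ}
    (hD0 : 0 ≤ D) (hD : ∀ r ∈ net.virtualRegion, ∀ q, |r q| ≤ D) (hb : ∀ t q, 0 ≤ b t q)
    (ha : (fun q => a q + ε) ∈ net.virtualRegion) (s : ℕ) :
    lyapunov D (u (s + 2)) (u (s + 1)) + 2 * ε * ∑ q, u (s + 1) q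
      ≤ lyapunov D (u (s + 1)) (u s) + 2 * ∑ q, u (s + 1) q * (b (s + 1) q - a q)
        + arrivalCost D (b (s + 1)) := by
  have hopt := h.dotProduct_le_slotRate hD ha s
  have hterm : ∀ q, u (s + 2) q ^ 2 + 4 * D * (|u (s + 2) q - u (s + 1) q| + u (s + 2) q)
      ≤ u (s + 1) q ^ 2 + 2 * (u (s + 1) q * (b (s + 1) q - net.slotRate R (s + 1) q))
        + ((b (s + 1) q + D) ^ 2 + 8 * D * (b (s + 1) q + D)) + 4 * D * u (s + 1) q := fun q => by
    have hb' := hb (s + 1) q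
    have hinc := h.backlog_succ_le hD hb (t := s + 1) (by omega) q
    have hdyn := h.dynamics (s + 1) (by omega) q
    have hr := abs_le.1 (h.abs_slotRate_le hD (t := s + 1) (by omega) q)
    have hx := h.backlog_nonneg (s + 2) q
    set x := u (s + 2) q
    set y := u (s + 1) q
    set r := net.slotRate R (s + 1) q
    set β := b (s + 1) q
    have hsq : x ^ 2 ≤ (y - r + β) ^ 2 := by
      rcases max_cases (y - r + β) 0 with ⟨hm, hm'⟩ | ⟨hm, hm'⟩
      · exact pow_le_pow_left₀ hx (hdyn.trans hm.le) 2
      · have : x = 0 := le_antisymm (hdyn.trans hm.le) hx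
        rw [this, zero_pow two_ne_zero]; positivity
    have hsq' : (β - r) ^ 2 ≤ (β + D) ^ 2 := sq_le_sq' (by linarith) (by linarith)
    -- On a rise the left side is `2 * x - y`; on a fall it is just `y`, however large the fall.
    have habs : |x - y| + x ≤ 2 * (β + D) + y := by
      rcases abs_cases (x - y) with ⟨he, -⟩ | ⟨he, -⟩ <;> rw [he] <;> linarith
    have := mul_le_mul_of_nonneg_left habs (by positivity : 0 ≤ 4 * D)
    nlinarith
  have hsum := Finset.sum_le_sum fun q (_ : q ∈ (Finset.univ : Finset net.Queue)) => hterm q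
  -- Doubling `hopt` turns its loss into `4 * D * ∑ |u (s+1) - u s|`, exactly the variation term of
  -- the old Lyapunov value; the two terms `4 * D * ∑ u (s+1)` cancel as well.
  simp only [lyapunov, arrivalCost, dotProduct, mul_add, mul_sub, Finset.sum_add_distrib,
    Finset.sum_sub_distrib, ← Finset.mul_sum, ← Finset.sum_mul] at hsum hopt ⊢
  linarith

/-- The accumulated backlog is bounded by the initial data and the arrivals. -/
lemma sum_backlog_le (h : net.IterativeMDBPath b u R) {D ε : ℝ} {a : net.Queue → ℝ}
    (hD0 : 0 ≤ D) (hD : ∀ r ∈ net.virtualRegion, ∀ q, |r q| ≤ D) (hb : ∀ t q, 0 ≤ b t q)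
    (ha : (fun q => a q + ε) ∈ net.virtualRegion) (n : ℕ) :
    2 * ε * ∑ t ∈ Finset.Icc 1 n, ∑ q, u t q
      ≤ lyapunov D (u 1) (u 0) + ∑ t ∈ Finset.Icc 1 n,
        (2 * ∑ q, u t q * (b t q - a q) + arrivalCost D (b t)) := by
  -- The terminal Lyapunov value is kept so that the drift telescopes; it is nonnegative and dropped
  -- at the end.
  suffices H : lyapunov D (u (n + 1)) (u n) + 2 * ε * ∑ t ∈ Finset.Icc 1 n, ∑ q, u t q
      ≤ lyapunov D (u 1) (u 0) + ∑ t ∈ Finset.Icc 1 n,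
        (2 * ∑ q, u t q * (b t q - a q) + arrivalCost D (b t)) by
    linarith [lyapunov_nonneg hD0 (u n) (h.backlog_nonneg (n + 1))]
  induction n with
  | zero => simp
  | succ n ih =>
    rw [Finset.sum_Icc_succ_top (by omega), Finset.sum_Icc_succ_top (by omega)]
    linarith [h.lyapunov_drift hD0 hD hb ha n]

end IterativeMDBPath

end WirelessNetwork

/-! ### Stability from truncated means -/

/-- A nonnegative process is stable if, up to events of arbitrarily small probability, its averaged
truncated means are bounded. -/
lemma IsStableQueue.of_forall_exists_truncation {Ω : Type*} [MeasurableSpace Ω] {μ : Measure Ω}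
    [IsProbabilityMeasure μ] {X : ℕ → Ω → ℝ} (hX : ∀ t, 0 ≤ᵐ[μ] X t)
    (h : ∀ δ > 0, ∃ A : Set Ω, μ.real Aᶜ ≤ δ ∧ (∀ t, 1 ≤ t → Integrable (A.indicator (X t)) μ) ∧
      ∃ C : ℝ, ∀ n : ℕ, 1 ≤ n → ∑ t ∈ Finset.Icc 1 n, ∫ ω, A.indicator (X t) ω ∂μ ≤ n * C) :
    IsStableQueue μ X := by
  -- A real `limsup` is informative only for bounded sequences.
  have hone : ∀ ξ : ℝ, ∀ n : ℕ,
      (1 / (n : ℝ)) * ∑ t ∈ Finset.Icc 1 n, μ.real {ω | ξ < X t ω} ≤ 1 := fun ξ n => by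
    have : ∑ t ∈ Finset.Icc 1 n, μ.real {ω | ξ < X t ω} ≤ n := by
      simpa using Finset.sum_le_sum fun t (_ : t ∈ Finset.Icc 1 n) =>
        (measureReal_le_one : μ.real {ω | ξ < X t ω} ≤ 1)
    rw [one_div, inv_mul_eq_div]
    exact div_le_one_of_le₀ this n.cast_nonneg
  have hnonneg : ∀ ξ : ℝ, ∀ n : ℕ,
      0 ≤ (1 / (n : ℝ)) * ∑ t ∈ Finset.Icc 1 n, μ.real {ω | ξ < X t ω} := fun ξ n => by positivity
  have hlim0 : ∀ ξ : ℝ, 0 ≤ limsup (fun n : ℕ =>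
      (1 / (n : ℝ)) * ∑ t ∈ Finset.Icc 1 n, μ.real {ω | ξ < X t ω}) atTop := fun ξ =>
    le_limsup_of_frequently_le (Frequently.of_forall (hnonneg ξ))
      (isBoundedUnder_of ⟨1, hone ξ⟩)
  refine tendsto_order.2 ⟨fun c hc => Eventually.of_forall fun ξ => hc.trans_le (hlim0 ξ),
    fun c hc => ?_⟩
  -- One third of `c` pays for the complement of `A`, one for Markov's inequality on `A`; the last
  -- keeps the inequality strict.
  obtain ⟨A, hA, hint, C, hC⟩ := h (c / 3) (by positivity)
  have hξ : ∀ᶠ ξ : ℝ in atTop, C / ξ < c / 3 :=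
    (tendsto_const_nhds.div_atTop tendsto_id).eventually_lt_const (by positivity)
  filter_upwards [hξ, eventually_gt_atTop 0] with ξ hξ hξ0
  refine (limsup_le_of_le (a := c / 3 + c / 3)
    (isCoboundedUnder_le_of_le atTop (hnonneg ξ)) ?_).trans_lt (by linarith)
  filter_upwards [eventually_ge_atTop 1] with n hn
  have hn0 : (0 : ℝ) < n := by exact_mod_cast hn
  have hterm : ∀ t ∈ Finset.Icc 1 n, μ.real {ω | ξ < X t ω}
      ≤ c / 3 + (∫ ω, A.indicator (X t) ω ∂μ) / ξ := fun t ht => by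
    have hmarkov := mul_meas_ge_le_integral_of_nonneg (μ := μ) (f := A.indicator (X t))
      ((hX t).mono fun ω hω => Set.indicator_apply_nonneg fun _ => hω)
      (hint t (Finset.mem_Icc.1 ht).1) ξ
    have hsub : {ω | ξ < X t ω} ⊆ Aᶜ ∪ {ω | ξ ≤ A.indicator (X t) ω} := fun ω hω => by
      by_cases hωA : ω ∈ A
      · right
        rw [Set.mem_ofPred_eq, Set.indicator_of_mem hωA]
        exact le_of_lt hω
      · exact Or.inl hωA
    calc μ.real {ω | ξ < X t ω} ≤ μ.real Aᶜ + μ.real {ω | ξ ≤ A.indicator (X t) ω} :=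
          (measureReal_mono hsub).trans (measureReal_union_le _ _)
      _ ≤ c / 3 + (∫ ω, A.indicator (X t) ω ∂μ) / ξ :=
          add_le_add hA ((le_div_iff₀' hξ0).2 hmarkov)
  have hsum := Finset.sum_le_sum hterm
  rw [Finset.sum_add_distrib, Finset.sum_const, ← Finset.sum_div] at hsum
  simp only [Nat.card_Icc, Nat.add_sub_cancel, nsmul_eq_mul] at hsum
  rw [one_div, inv_mul_le_iff₀ hn0]
  calc ∑ t ∈ Finset.Icc 1 n, μ.real {ω | ξ < X t ω}
      ≤ n * (c / 3) + (∑ t ∈ Finset.Icc 1 n, ∫ ω, A.indicator (X t) ω ∂μ) / ξ := hsum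
    _ ≤ n * (c / 3) + n * C / ξ := by gcongr; exact hC n hn
    _ = n * (c / 3 + C / ξ) := by ring
    _ ≤ n * (c / 3 + c / 3) := by gcongr

/-- A real random variable is bounded up to events of arbitrarily small probability. -/
lemma exists_nat_measureReal_lt_le {Ω : Type*} [MeasurableSpace Ω] {μ : Measure Ω}
    [IsFiniteMeasure μ] {W : Ω → ℝ} (hW : Measurable W) {δ : ℝ} (hδ : 0 < δ) :
    ∃ m : ℕ, μ.real {ω | (m : ℝ) < W ω} ≤ δ := by
  have htend : Tendsto (fun m : ℕ => μ {ω | (m : ℝ) < W ω}) atTop (𝓝 0) := by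
    have hempty : ⋂ m : ℕ, {ω | (m : ℝ) < W ω} = ∅ := by
      ext ω
      obtain ⟨m, hm⟩ := exists_nat_ge (W ω)
      simpa using ⟨m, hm⟩
    have := tendsto_measure_iInter_atTop (μ := μ) (s := fun m : ℕ => {ω | (m : ℝ) < W ω})
      (fun m => (measurableSet_lt measurable_const hW).nullMeasurableSet)
      (fun i j hij ω (hω : (j : ℝ) < W ω) => show (i : ℝ) < W ω from
        lt_of_le_of_lt (Nat.cast_le.2 hij) hω) ⟨0, measure_ne_top _ _⟩
    rwa [hempty, measure_empty] at this
  have hreal : Tendsto (fun m : ℕ => μ.real {ω | (m : ℝ) < W ω}) atTop (𝓝 0) :=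
    (ENNReal.tendsto_toReal ENNReal.zero_ne_top).comp htend
  exact ((hreal.eventually_lt_const hδ).mono fun m hm => hm.le).exists

/-- A point of the interior can be increased by the same amount in all coordinates. -/
lemma exists_pos_add_mem_of_mem_interior {ι : Type*} [Fintype ι] {s : Set (ι → ℝ)} {a : ι → ℝ}
    (ha : a ∈ interior s) : ∃ ε > 0, (fun q => a q + ε) ∈ s := by
  have hcont : Tendsto (fun ε : ℝ => fun q => a q + ε) (𝓝[>] 0) (𝓝 a) := by
    have : Continuous fun ε : ℝ => fun q => a q + ε := by fun_prop
    simpa using (this.tendsto 0).mono_left nhdsWithin_le_nhds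
  obtain ⟨ε, hε, hmem⟩ := ((hcont.eventually (mem_interior_iff_mem_nhds.1 ha)).and
    self_mem_nhdsWithin).exists
  exact ⟨ε, hmem, hε⟩

/-! ### Moments of the arrivals and independence of the past -/

namespace IsIIDArrival

variable {Ω ι : Type*} [MeasurableSpace Ω] {μ : Measure Ω}
  {B : ℕ → Ω → ι → ℝ} {a : ι → ℝ}

lemma integrable_coord [IsFiniteMeasure μ] (hB : IsIIDArrival μ B a) (t : ℕ) (q : ι) :
    Integrable (fun ω => B t ω q) μ :=
  (hB.memLp_two t q).integrable one_le_two

lemma integrable_arrivalCost [Fintype ι] [IsFiniteMeasure μ] (hB : IsIIDArrival μ B a) (D : ℝ)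
    (t : ℕ) : Integrable (fun ω => WirelessNetwork.arrivalCost D (B t ω)) μ := by
  refine integrable_finsetSum _ fun q _ => ?_
  have := (hB.memLp_two t q).add (memLp_const D)
  exact this.integrable_sq.add ((this.integrable one_le_two).const_mul _)

lemma integral_arrivalCost [Fintype ι] (hB : IsIIDArrival μ B a) (D : ℝ) (t : ℕ) :
    ∫ ω, WirelessNetwork.arrivalCost D (B t ω) ∂μ
      = ∫ ω, WirelessNetwork.arrivalCost D (B 0 ω) ∂μ := by
  have hmeas : Measurable (WirelessNetwork.arrivalCost D : (ι → ℝ) → ℝ) := by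
    unfold WirelessNetwork.arrivalCost
    fun_prop
  exact ((hB.identDistrib t).comp hmeas).integral_eq

end IsIIDArrival

/-- Arrivals are uncorrelated with whatever is determined by the past. -/
lemma integrable_and_integral_mul_arrival_sub_mean {Ω ι : Type*} {m : MeasurableSpace Ω}
    [MeasurableSpace Ω] {μ : Measure Ω} [IsProbabilityMeasure μ] {B : ℕ → Ω → ι → ℝ} {a : ι → ℝ}
    (hB : IsIIDArrival μ B a) {t : ℕ} (q : ι)
    (hind : Indep (MeasurableSpace.comap (B t) inferInstance) m μ) {Y : Ω → ℝ}
    (hY : Measurable[m] Y) (hYint : Integrable Y μ) :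
    Integrable (fun ω => Y ω * (B t ω q - a q)) μ ∧ ∫ ω, Y ω * (B t ω q - a q) ∂μ = 0 := by
  have hBint : Integrable (fun ω => B t ω q - a q) μ :=
    (hB.integrable_coord t q).sub (integrable_const _)
  have hindep : IndepFun Y (fun ω => B t ω q - a q) μ := by
    rw [IndepFun_iff_Indep]
    refine indep_of_indep_of_le_left (indep_of_indep_of_le_right hind.symm ?_) hY.comap_le
    have hf : Measurable fun b : ι → ℝ => b q - a q := (measurable_pi_apply q).sub_const _
    have : (fun ω => B t ω q - a q) = (fun b : ι → ℝ => b q - a q) ∘ B t := rfl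
    rw [this, ← MeasurableSpace.comap_comp]
    exact MeasurableSpace.comap_mono hf.comap_le
  -- Independence makes the product integrable without a second moment of `Y`.
  refine ⟨hindep.integrable_mul hYint hBint, ?_⟩
  have hmul := hindep.integral_mul_eq_mul_integral hYint.1 hBint.1
  have hzero : ∫ ω, (B t ω q - a q) ∂μ = 0 := by
    rw [integral_sub (hB.integrable_coord t q) (integrable_const _), hB.mean]
    simp
  rw [hzero, mul_zero] at hmul
  exact hmul

/-! ### Throughput optimality -/

theorem theorem4 {N K : Type*} [Fintype N] [DecidableEq N] [Fintype K]
    (net : WirelessNetwork N K) (hcompact : IsCompact net.longTermRegion)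
    {Ω : Type*} [MeasurableSpace Ω] (μ : Measure Ω) [IsProbabilityMeasure μ]
    (B U : ℕ → Ω → net.Queue → ℝ) (R : ℝ → Ω → net.Link → K → ℝ) (a : net.Queue → ℝ)
    (hB : IsIIDArrival μ B a) (ha : a ∈ interior net.virtualRegion)
    (hMDB : net.IsIterativeMDB μ B U R) :
    ∀ q : net.Queue, IsStableQueue μ (fun t ω => U t ω q) := by
  intro q₀
  obtain ⟨D, hD0, hD⟩ := net.exists_abs_le_of_mem_virtualRegion hcompact
  obtain ⟨ε, hε, haε⟩ := exists_pos_add_mem_of_mem_interior ha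
  obtain ⟨ℱ, hU, -, hind⟩ := hMDB.causal
  have hpath : ∀ᵐ ω ∂μ,
      net.IterativeMDBPath (fun t => B t ω) (fun t => U t ω) (fun τ => R τ ω) ∧
        ∀ t q, 0 ≤ B t ω q := hMDB.path.and (ae_all_iff.2 hB.nonneg)
  refine IsStableQueue.of_forall_exists_truncation
    (fun t => hpath.mono fun ω hω => hω.1.backlog_nonneg t q₀) fun δ hδ => ?_
  -- The Lyapunov term bounds the start of the telescoped sum on `A`; the added backlog makes the
  -- truncated `U 1` bounded, hence integrable.
  set W : Ω → ℝ := fun ω => WirelessNetwork.lyapunov D (U 1 ω) (U 0 ω) + ∑ q, U 1 ω q with hWdef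
  have hW : Measurable[ℱ 1] W := by
    have h0 : ∀ q, Measurable[ℱ 1] fun ω => U 0 ω q := fun q =>
      @measurable_pi_iff _ _ _ (ℱ 1) _ _ |>.1 ((hU 0).mono (ℱ.mono zero_le_one) le_rfl) q
    have h1 : ∀ q, Measurable[ℱ 1] fun ω => U 1 ω q := fun q =>
      @measurable_pi_iff _ _ _ (ℱ 1) _ _ |>.1 (hU 1) q
    simp only [hWdef, WirelessNetwork.lyapunov]
    fun_prop
  obtain ⟨m, hm⟩ := exists_nat_measureReal_lt_le (μ := μ) (hW.mono (ℱ.le 1) le_rfl) hδ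
  set A : Set Ω := {ω | W ω ≤ m} with hAdef
  -- As `A` is decided at time 1, truncation keeps `Y t q` measurable for `ℱ t` when `1 ≤ t`, hence
  -- independent of `B t`.
  have hA : MeasurableSet[ℱ 1] A := hW measurableSet_Iic
  set Y : ℕ → net.Queue → Ω → ℝ := fun t q => A.indicator fun ω => U t ω q with hYdef
  have hYmeas : ∀ t, 1 ≤ t → ∀ q, Measurable[ℱ t] (Y t q) := fun t ht q =>
    (@measurable_pi_iff _ _ _ (ℱ t) _ _ |>.1 (hU t) q).indicator (ℱ.mono ht _ hA)
  have hYint : ∀ t, 1 ≤ t → ∀ q, Integrable (Y t q) μ := by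
    intro t ht
    induction t, ht using Nat.le_induction with
    | base =>
      intro q
      refine (integrable_const (m : ℝ)).mono' ((hYmeas 1 le_rfl q).mono (ℱ.le 1)
        le_rfl).aestronglyMeasurable ?_
      filter_upwards [hpath] with ω hω
      have h0 := hω.1.backlog_nonneg 1
      by_cases hωA : ω ∈ A
      · simp only [hYdef, Set.indicator_of_mem hωA, Real.norm_of_nonneg (h0 q)]
        have hWm : W ω ≤ m := hωA
        have hle := Finset.single_le_sum (fun q _ => h0 q) (Finset.mem_univ q)
        have hly := WirelessNetwork.lyapunov_nonneg hD0 (U 0 ω) h0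
        simp only [hWdef] at hWm
        linarith
      · simp [hYdef, Set.indicator_of_notMem hωA]
    | succ t ht ih =>
      intro q
      refine ((ih q).add ((hB.integrable_coord t q).add (integrable_const D))).mono'
        ((hYmeas (t + 1) (by omega) q).mono (ℱ.le _) le_rfl).aestronglyMeasurable ?_
      filter_upwards [hpath] with ω hω
      by_cases hωA : ω ∈ A
      · simp only [hYdef, Set.indicator_of_mem hωA, Pi.add_apply,
          Real.norm_of_nonneg (hω.1.backlog_nonneg (t + 1) q)]
        exact hω.1.backlog_succ_le hD hω.2 ht q
      · simp only [hYdef, Set.indicator_of_notMem hωA, Pi.add_apply, norm_zero]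
        linarith [hω.2 t q]
  have hcross := fun t (ht : 1 ≤ t) q =>
    integrable_and_integral_mul_arrival_sub_mean hB q (hind t) (hYmeas t ht q) (hYint t ht q)
  refine ⟨A, ?_, fun t ht => hYint t ht q₀, ?_⟩
  · have : Aᶜ = {ω | (m : ℝ) < W ω} := by ext ω; simp [hAdef]
    rwa [this]
  have hae : ∀ n : ℕ, ∀ᵐ ω ∂μ, 2 * ε * ∑ t ∈ Finset.Icc 1 n, Y t q₀ ω
      ≤ m + ∑ t ∈ Finset.Icc 1 n, (2 * ∑ q, Y t q ω * (B t ω q - a q)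
        + WirelessNetwork.arrivalCost D (B t ω)) := fun n => by
    filter_upwards [hpath] with ω hω
    by_cases hωA : ω ∈ A
    · simp only [hYdef, Set.indicator_of_mem hωA]
      have hsum := hω.1.sum_backlog_le hD0 hD hω.2 haε n
      have hWm : W ω ≤ m := hωA
      have h1 : 0 ≤ ∑ q, U 1 ω q := Finset.sum_nonneg fun q _ => hω.1.backlog_nonneg 1 q
      have hle : 2 * ε * ∑ t ∈ Finset.Icc 1 n, U t ω q₀
          ≤ 2 * ε * ∑ t ∈ Finset.Icc 1 n, ∑ q, U t ω q := by
        gcongr with t ht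
        exact Finset.single_le_sum (fun q _ => hω.1.backlog_nonneg t q) (Finset.mem_univ q₀)
      simp only [hWdef] at hWm
      linarith
    · simp only [hYdef, Set.indicator_of_notMem hωA, zero_mul, Finset.sum_const_zero, mul_zero,
        zero_add]
      have : ∀ t, 0 ≤ WirelessNetwork.arrivalCost D (B t ω) := fun t =>
        Finset.sum_nonneg fun q _ => by have := hω.2 t q; positivity
      have := Finset.sum_nonneg fun t (_ : t ∈ Finset.Icc 1 n) => this t
      positivity
  set c := ∫ ω, WirelessNetwork.arrivalCost D (B 0 ω) ∂μ
  -- Taking expectations gives `m + n * c` on the right, at most `n * (m + c)` because `1 ≤ n`.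
  refine ⟨(m + c) / (2 * ε), fun n hn => ?_⟩
  have hsumint : ∀ t ∈ Finset.Icc 1 n,
      Integrable (fun ω => 2 * ∑ q, Y t q ω * (B t ω q - a q)) μ := fun t ht =>
    (integrable_finsetSum _ fun q _ => (hcross t (Finset.mem_Icc.1 ht).1 q).1).const_mul _
  have hterm : ∀ t ∈ Finset.Icc 1 n, Integrable (fun ω => 2 * ∑ q, Y t q ω * (B t ω q - a q)
      + WirelessNetwork.arrivalCost D (B t ω)) μ := fun t ht =>
    (hsumint t ht).add (hB.integrable_arrivalCost D t)
  have hY₀ : ∀ t ∈ Finset.Icc 1 n, Integrable (Y t q₀) μ := fun t ht =>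
    hYint t (Finset.mem_Icc.1 ht).1 q₀
  have hmono := integral_mono_ae ((integrable_finsetSum _ hY₀).const_mul (2 * ε))
    ((integrable_const (m : ℝ)).add (integrable_finsetSum _ hterm)) (hae n)
  have hval : ∀ t ∈ Finset.Icc 1 n, ∫ ω, (2 * ∑ q, Y t q ω * (B t ω q - a q)
      + WirelessNetwork.arrivalCost D (B t ω)) ∂μ = c := fun t ht => by
    rw [integral_add (hsumint t ht) (hB.integrable_arrivalCost D t), integral_const_mul,
      integral_finsetSum _ fun q _ => (hcross t (Finset.mem_Icc.1 ht).1 q).1,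
      hB.integral_arrivalCost D t]
    simp [(hcross t (Finset.mem_Icc.1 ht).1 _).2, c]
  rw [integral_const_mul, integral_finsetSum _ hY₀] at hmono
  simp only [Pi.add_apply] at hmono
  rw [integral_add (integrable_const _) (integrable_finsetSum _ hterm),
    integral_finsetSum _ hterm, Finset.sum_congr rfl hval] at hmono
  simp only [integral_const, probReal_univ, smul_eq_mul, one_mul, Finset.sum_const, Nat.card_Icc,
    Nat.add_sub_cancel, nsmul_eq_mul] at hmono
  have hn1 : (1 : ℝ) ≤ n := by exact_mod_cast hn
  have hm0 : (0 : ℝ) ≤ m := m.cast_nonneg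
  rw [← mul_div_assoc, le_div_iff₀' (by positivity)]
  nlinarith
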